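/- **Theorem 1.2 (Exceptional Congruences).** For integers $j,m\ge 0$ let $$H(\{1\}^j;m)=\sum_{m\ge i_1>\cdots>i_j\ge 1}\frac1{i_1\cdots i_j}$$ (so $H(\{1\}^0;m)=1$, and $H(\{1\}^j;m)=0$ if $m<j$). For integers $0\le j\le n$ let $b_{j,n}(T)\in\mathbb{Q}[T]$ be the unique polynomial of degree at most $2n+1$ with $$b_{j,n}(T)\equiv (T-1)^j \pmod{(T-1)^{n+1}},\qquad b_{j,n}(T)\equiv (-1)^jT^j \pmod{T^{n+1}}.$$ For rational numbers $a,b$ and a prime $p$, $a\equiv b\pmod{p^m}$ means that $a-b=p^m r$ for a rational number $r$ whose denominator is prime to $p$. $B_m$ denotes the $m$-th Bernoulli number, and for $x\in\mathbb Z$ and an integer $r\ge 0$, $\binom{x}{r}=\frac{x(x-1)\cdots(x-r+1)}{r!}$. Let $n\ge 0$ be an integer, $p$ an odd prime, and $k\in\mathbb{Z}$ arbitrary. Put $$E=\binom{kp-1}{p-1}-\sum_{j=0}^{n} b_{j,n}(k)\,p^jH(\{1\}^j;p-1).$$ (i) Suppose $p\ge 2n+5$. The congruence $$\binom{kp-1}{p-1}\equiv\sum_{j=0}^{n}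 b_{j,n}(k)\,p^jH(\{1\}^j;p-1)\pmod{p^{2n+4}}$$ holds if and only if either $k\equiv 0,1\pmod p$ or $p$ divides the numerator of the Bernoulli number $B_{p-2n-3}$. Moreover, $$E\equiv -\frac{B_{p-2n-3}}{2n+3}\,k^{n+1}(k-1)^{n+1}p^{2n+3}\pmod{p^{2n+4}}.$$ (ii) Suppose $p=2n+3$. The congruence $$\binom{kp-1}{p-1}\equiv\sum_{j=0}^{n} b_{j,n}(k)\,p^jH(\{1\}^j;p-1)\pmod{p^{2n+3}}$$ holds if and only if $k\equiv 0,1\pmod p$. -/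

import Mathlib

section

open Polynomial

/-- The multiple harmonic sum `H(l; n) = ∑_{n ≥ i₁ > ⋯ > i_j ≥ 1} 1 / (i₁ ^ l₁ ⋯ i_j ^ l_j)`
of a finite list `l = (l₁, …, l_j)` of exponents. It is `1` for the empty list, and the sum is empty
when `n < j`. -/
def multipleHarmonicSum {j : ℕ} (l : Fin j → ℕ) (n : ℕ) : ℚ :=
  ∑ i ∈ (Fintype.piFinset fun _ : Fin j => Finset.Icc 1 n) with (∀ s t, s < t → i t < i s),
    ∏ t, 1 / (i t : ℚ) ^ l t

/-- The conditions that characterize the extremal polynomial `b_{j,n}(T)`: it has degree at most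
`2n + 1`, it is congruent to `(T - 1)^j` modulo `(T - 1)^(n+1)`, and it is congruent to
`(-1)^j T^j` modulo `T^(n+1)`. -/
structure IsExtremalPolynomial (j n : ℕ) (b : ℚ[X]) : Prop where
  natDegree_le : b.natDegree ≤ 2 * n + 1
  congr_one : (X - 1) ^ (n + 1) ∣ b - (X - 1) ^ j
  congr_zero : X ^ (n + 1) ∣ b - (-1) ^ j * X ^ j

theorem existsUnique_isExtremalPolynomial (j n : ℕ) : ∃! b : ℚ[X], IsExtremalPolynomial j n b := by
  have hco : IsCoprime ((X - 1 : ℚ[X]) ^ (n + 1)) (X ^ (n + 1)) :=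
    IsCoprime.pow ⟨-1, 1, by ring⟩
  have hm : ((X - 1 : ℚ[X]) ^ (n + 1) * X ^ (n + 1)).Monic := by
    have h1 : (X - 1 : ℚ[X]).Monic := by simpa using monic_X_sub_C (1 : ℚ)
    exact (h1.pow _).mul (monic_X.pow _)
  have hd : ((X - 1 : ℚ[X]) ^ (n + 1) * X ^ (n + 1)).natDegree = 2 * n + 2 := by
    have h1 : (X - 1 : ℚ[X]).Monic := by simpa using monic_X_sub_C (1 : ℚ)
    have h2 : (X - 1 : ℚ[X]).natDegree = 1 := by simpa using natDegree_X_sub_C (1 : ℚ)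
    rw [(h1.pow _).natDegree_mul (monic_X.pow _), h1.natDegree_pow, natDegree_X_pow, h2]
    ring
  obtain ⟨u, v, huv⟩ := id hco
  set M : ℚ[X] := (X - 1) ^ (n + 1) * X ^ (n + 1) with hM
  set f : ℚ[X] := (X - 1) ^ j * (v * X ^ (n + 1)) + (-1) ^ j * X ^ j * (u * (X - 1) ^ (n + 1))
    with hf
  have hfM : f %ₘ M = f - M * (f /ₘ M) := by
    rw [eq_sub_iff_add_eq]; exact modByMonic_add_div f M
  refine ⟨f %ₘ M, ⟨?_, ?_, ?_⟩, ?_⟩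
  · have := natDegree_modByMonic_lt f hm (by intro h; rw [h] at hd; simp at hd)
    omega
  · refine ⟨((-1) ^ j * X ^ j - (X - 1) ^ j) * u - X ^ (n + 1) * (f /ₘ M), ?_⟩
    rw [hfM]
    linear_combination (X - 1) ^ j * huv
  · refine ⟨((X - 1) ^ j - (-1) ^ j * X ^ j) * v - (X - 1) ^ (n + 1) * (f /ₘ M), ?_⟩
    rw [hfM]
    linear_combination (-1) ^ j * X ^ j * huv
  · rintro b ⟨h0, h1, h2⟩
    have hMb : M ∣ b - f := by
      refine hco.mul_dvd ?_ ?_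
      · obtain ⟨c, hc⟩ := h1
        refine ⟨c - ((-1) ^ j * X ^ j - (X - 1) ^ j) * u, ?_⟩
        linear_combination hc - (X - 1) ^ j * huv
      · obtain ⟨c, hc⟩ := h2
        refine ⟨c - ((X - 1) ^ j - (-1) ^ j * X ^ j) * v, ?_⟩
        linear_combination hc - (-1) ^ j * X ^ j * huv
    have hb : b %ₘ M = b := by
      rw [modByMonic_eq_self_iff hm]
      refine degree_lt_degree ?_
      omega
    rw [← hb]
    have := (modByMonic_eq_zero_iff_dvd hm).2 hMb
    rw [sub_modByMonic] at this
    exact sub_eq_zero.1 this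

/-- The extremal polynomial `b_{j,n}(T)`: the unique polynomial that satisfies the conditions of
`IsExtremalPolynomial j n`. -/
noncomputable def extremalPolynomial (j n : ℕ) : ℚ[X] :=
  (existsUnique_isExtremalPolynomial j n).choose

theorem isExtremalPolynomial_extremalPolynomial (j n : ℕ) :
    IsExtremalPolynomial j n (extremalPolynomial j n) :=
  (existsUnique_isExtremalPolynomial j n).choose_spec.1

/-- The congruence `a ≡ b (mod p ^ m)` of rational numbers: the difference `a - b` is `p ^ m` times
a rational number whose denominator is prime to `p`. -/
def RatCongr (p m : ℕ) (a b : ℚ) : Prop :=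
  ∃ r : ℚ, r.den.Coprime p ∧ a - b = (p : ℚ) ^ m * r

/-- The right-hand side `∑_{j=0}^n b_{j,n}(k) p^j H({1}^j; p-1)` of the optimized congruence. -/
noncomputable def optimizedSum (n p : ℕ) (k : ℤ) : ℚ :=
  ∑ j ∈ Finset.range (n + 1), (extremalPolynomial j n).eval (k : ℚ) * (p : ℚ) ^ j *
    multipleHarmonicSum (fun _ : Fin j => 1) (p - 1)

end

/-!
Write `H_j` for `H({1}^j; p - 1)`. Since `p` is odd, the binomial coefficient `choose (kp - 1) (p - 1)` is
the value at `T = k` of `F(T) = ∏_{0 < i < p} (1 - pT / i) = ∑_j (-p)^j H_j T^j`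
(`choose_mul_sub_one_eq_eval`). The substitution `i ↦ p - i` shows `F(T) = F(1 - T)`, so that also
`F(T) = ∑_j p^j H_j (T - 1)^j`. Truncating the two expansions and comparing with the congruences that
define the extremal polynomials, one sees that `∑_{j ≤ n} p^j H_j b_{j,n}(T)` is the remainder of `F`
modulo the monic polynomial `M = T^(n+1) (T - 1)^(n+1)` of degree `2n + 2`. The error term is
therefore `M(k)` times the value at `k` of the quotient, which is `∑_j (-p)^j H_j q_j` with integers
`q_j`, where `q_j = 0` for `j < 2n + 2` and `q_{2n+2} = 1` (`choose_sub_optimizedSum`).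

If `p = 2n + 3`, only the term `j = p - 1` is left, with `H_{p-1} = 1 / (p - 1)!`, a `p`-adic unit.
If `p ≥ 2n + 5`, then `p ∣ H_j` for `1 ≤ j ≤ p - 2`, so modulo `p^(2n+4)` only the term `j = 2n + 2`
counts, and `H_{2n+2}` is needed modulo `p^2`. It equals `e_r / (p - 1)!`, where `e_r` is the
elementary symmetric function of `1, …, p - 1` of degree `r = p - 2n - 3`. Newton's identities,
with all lower `e_a` and power sums divisible by `p`, give `r e_r ≡ -∑ i^r` modulo `p^2` for even
`r`, and Faulhaber's formula gives `∑ i^r ≡ p B_r`. With `r ≡ -(2n + 3)` and Wilson's theorem this is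
`H_{2n+2} ≡ -p B_r / (2n + 3)` modulo `p^2` (`multipleHarmonicSum_add_mem_two`).
-/

section

open Polynomial

/-! ### Elementary symmetric functions and multiple harmonic sums -/

theorem Finset.prod_one_add_mul_eq_sum_powersetCard {ι R : Type*} [CommRing R]
    (s : Finset ι) (a : R) (f : ι → R) :
    ∏ i ∈ s, (1 + a * f i) =
      ∑ j ∈ Finset.range (s.card + 1), a ^ j * ∑ t ∈ s.powersetCard j, ∏ i ∈ t, f i := by
  rw [Finset.prod_one_add, Finset.sum_powerset]
  refine Finset.sum_congr rfl fun j _ => ?_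
  rw [Finset.mul_sum]
  refine Finset.sum_congr rfl fun t ht => ?_
  rw [Finset.prod_mul_distrib, Finset.prod_const, (Finset.mem_powersetCard.1 ht).2]

/-- Newton's identities for the values of a function on a finite set. -/
theorem Finset.newton_identity {ι R : Type*} [CommRing R] (s : Finset ι) (f : ι → R) (k : ℕ) :
    k * ∑ t ∈ s.powersetCard k, ∏ i ∈ t, f i = (-1) ^ (k + 1) *
      ∑ a ∈ Finset.HasAntidiagonal.antidiagonal k with a.1 < k,
        (-1) ^ a.1 * (∑ t ∈ s.powersetCard a.1, ∏ i ∈ t, f i) * ∑ i ∈ s, f i ^ a.2 := by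
  have he (r : ℕ) : MvPolynomial.aeval (fun i : s => f i) (MvPolynomial.esymm s R r) =
      ∑ t ∈ s.powersetCard r, ∏ i ∈ t, f i := by
    rw [MvPolynomial.aeval_esymm_eq_multiset_esymm, ← Finset.esymm_map_val]
    congr 1
    exact Multiset.attach_map_val' s.val f
  have hp (r : ℕ) : MvPolynomial.aeval (fun i : s => f i) (MvPolynomial.psum s R r) =
      ∑ i ∈ s, f i ^ r := by
    simp [MvPolynomial.psum, Finset.sum_attach s (fun i => f i ^ r)]
  have h := congrArg (MvPolynomial.aeval (fun i : s => f i)) (MvPolynomial.mul_esymm_eq_sum s R k)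
  simpa only [map_mul, map_natCast, map_pow, map_neg, map_one, map_sum, he, hp] using h

/-- The elementary symmetric functions of the inverses are those of complementary degree, divided by
the product. -/
theorem Finset.prod_mul_sum_powersetCard_inv {ι K : Type*} [DecidableEq ι] [Field K]
    (s : Finset ι) (f : ι → K) (hf : ∀ i ∈ s, f i ≠ 0) {j : ℕ} (hj : j ≤ s.card) :
    (∏ i ∈ s, f i) * ∑ t ∈ s.powersetCard j, ∏ i ∈ t, 1 / f i =
      ∑ t ∈ s.powersetCard (s.card - j), ∏ i ∈ t, f i := by
  rw [Finset.mul_sum]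
  refine Finset.sum_nbij' (fun t => s \ t) (fun t => s \ t) ?_ ?_ ?_ ?_ ?_
  · intro t ht
    rw [Finset.mem_powersetCard] at ht ⊢
    exact ⟨Finset.sdiff_subset, by rw [Finset.card_sdiff_of_subset ht.1, ht.2]⟩
  · intro t ht
    rw [Finset.mem_powersetCard] at ht ⊢
    exact ⟨Finset.sdiff_subset, by rw [Finset.card_sdiff_of_subset ht.1, ht.2]; omega⟩
  · intro t ht
    exact Finset.sdiff_sdiff_eq_self (Finset.mem_powersetCard.1 ht).1
  · intro t ht
    exact Finset.sdiff_sdiff_eq_self (Finset.mem_powersetCard.1 ht).1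
  · intro t ht
    have hts := (Finset.mem_powersetCard.1 ht).1
    rw [← Finset.prod_sdiff hts, mul_assoc, ← Finset.prod_mul_distrib]
    rw [Finset.prod_congr rfl fun i hi => mul_one_div_cancel (hf i (hts hi)), Finset.prod_const_one,
      mul_one]

/-- `H({1}^j; m)` is the elementary symmetric function of degree `j` of `1, 1/2, …, 1/m`: a decreasing
tuple of indices is determined by its set of entries. -/
theorem multipleHarmonicSum_one_eq (j m : ℕ) :
    multipleHarmonicSum (fun _ : Fin j => 1) m =
      ∑ t ∈ (Finset.Icc 1 m).powersetCard j, ∏ i ∈ t, 1 / (i : ℚ) := by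
  classical
  unfold multipleHarmonicSum
  refine Finset.sum_bij (fun i _ => Finset.univ.image i) ?_ ?_ ?_ ?_
  · intro i hi
    rw [Finset.mem_filter, Fintype.mem_piFinset] at hi
    have ha : StrictAnti i := fun s t h => hi.2 s t h
    rw [Finset.mem_powersetCard, Finset.card_image_of_injective _ ha.injective]
    refine ⟨fun x hx => ?_, by simp⟩
    obtain ⟨s, -, rfl⟩ := Finset.mem_image.1 hx
    exact hi.1 s
  · intro i hi i' hi' h
    rw [Finset.mem_filter] at hi hi'
    have ha : StrictAnti i := fun s t h => hi.2 s t h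
    have ha' : StrictAnti i' := fun s t h => hi'.2 s t h
    refine (StrictAnti.range_inj ha ha').1 ?_
    simpa using congrArg (fun t : Finset ℕ => (t : Set ℕ)) h
  · intro t ht
    obtain ⟨hts, htc⟩ := Finset.mem_powersetCard.1 ht
    refine ⟨fun s => t.orderEmbOfFin htc s.rev, ?_, ?_⟩
    · rw [Finset.mem_filter, Fintype.mem_piFinset]
      exact ⟨fun s => hts (Finset.orderEmbOfFin_mem _ _ _), fun s s' h => by simpa using h⟩
    · rw [← Finset.coe_inj, Finset.coe_image, Finset.coe_univ, Set.image_univ,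
        ← Finset.range_orderEmbOfFin t htc]
      exact Fin.rev_surjective.range_comp (t.orderEmbOfFin htc)
  · intro i hi
    rw [Finset.mem_filter] at hi
    have ha : StrictAnti i := fun s t h => hi.2 s t h
    rw [Finset.prod_image ha.injective.injOn]
    simp

theorem prod_Icc_natCast_eq_factorial (m : ℕ) :
    ∏ i ∈ Finset.Icc 1 m, (i : ℚ) = (m.factorial : ℚ) := by
  rw [← Finset.prod_Ico_id_eq_factorial, Nat.cast_prod, Finset.Ico_add_one_right_eq_Icc]

theorem factorial_mul_multipleHarmonicSum {m j : ℕ} (hj : j ≤ m) :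
    (m.factorial : ℚ) * multipleHarmonicSum (fun _ : Fin j => 1) m =
      ∑ t ∈ (Finset.Icc 1 m).powersetCard (m - j), ∏ i ∈ t, (i : ℚ) := by
  have h := Finset.prod_mul_sum_powersetCard_inv (Finset.Icc 1 m) (fun i => (i : ℚ))
    (fun i hi => by have := (Finset.mem_Icc.1 hi).1; positivity) (j := j) (by simpa using hj)
  rw [multipleHarmonicSum_one_eq, ← prod_Icc_natCast_eq_factorial]
  simpa using h

theorem prod_one_add_mul_C_inv (m : ℕ) (a : ℚ[X]) :
    ∏ i ∈ Finset.Icc 1 m, (1 + a * C (1 / (i : ℚ))) =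
      ∑ j ∈ Finset.range (m + 1), a ^ j * C (multipleHarmonicSum (fun _ : Fin j => 1) m) := by
  rw [Finset.prod_one_add_mul_eq_sum_powersetCard]
  simp only [multipleHarmonicSum_one_eq, map_sum, map_prod, Nat.card_Icc, Nat.add_sub_cancel]

/-! ### The binomial coefficient as a polynomial in `k` -/

/-- The polynomial `∏_{0 < i < p} (1 - pT / i)`, whose value at an integer `k` is
`choose (kp - 1) (p - 1)` for odd `p`. -/
noncomputable def harmonicPolynomial (p : ℕ) : ℚ[X] :=
  ∏ i ∈ Finset.Icc 1 (p - 1), (1 + (-C (p : ℚ) * X) * C (1 / (i : ℚ)))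

theorem harmonicPolynomial_eq_sum (p : ℕ) (hp : 0 < p) :
    harmonicPolynomial p = ∑ j ∈ Finset.range p,
      C ((-1) ^ j * (p : ℚ) ^ j * multipleHarmonicSum (fun _ : Fin j => 1) (p - 1)) * X ^ j := by
  rw [harmonicPolynomial, prod_one_add_mul_C_inv, Nat.sub_add_cancel hp]
  refine Finset.sum_congr rfl fun j _ => ?_
  simp only [map_mul, map_pow, map_neg, map_one]
  rw [← neg_one_mul, mul_assoc, mul_pow, mul_pow]
  ring

/-- The symmetry `F(T) = F(1 - T)` of `harmonicPolynomial p`, a consequence of the substitution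
`i ↦ p - i`. -/
theorem harmonicPolynomial_eq_prod_reflected {p : ℕ} (hp : Odd p) :
    harmonicPolynomial p =
      ∏ i ∈ Finset.Icc 1 (p - 1), (1 + (C (p : ℚ) * (X - 1)) * C (1 / (i : ℚ))) := by
  have hev : Even (p - 1) := by obtain ⟨a, rfl⟩ := hp; simp
  have hne : ∏ i ∈ Finset.Icc 1 (p - 1), (C (i : ℚ)) ≠ 0 := by
    refine Finset.prod_ne_zero_iff.2 fun i hi => ?_
    have := (Finset.mem_Icc.1 hi).1
    simp only [ne_eq, map_eq_zero, Nat.cast_eq_zero]; omega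
  have hinv : ∀ i ∈ Finset.Icc 1 (p - 1), C (1 / (i : ℚ)) * C (i : ℚ) = 1 := by
    intro i hi
    have : (i : ℚ) ≠ 0 := by have := (Finset.mem_Icc.1 hi).1; positivity
    rw [← C_mul, one_div_mul_cancel this, C_1]
  -- Multiplied by `(p - 1)!`, the two sides are `∏ (i - pT)` and `∏ -((p - i) - pT)`.
  apply mul_right_cancel₀ hne
  rw [harmonicPolynomial, ← Finset.prod_mul_distrib, ← Finset.prod_mul_distrib]
  have h1 : ∏ i ∈ Finset.Icc 1 (p - 1), ((1 + (-C (p : ℚ) * X) * C (1 / (i : ℚ))) * C (i : ℚ)) =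
      ∏ i ∈ Finset.Icc 1 (p - 1), (C (i : ℚ) - C (p : ℚ) * X) := by
    refine Finset.prod_congr rfl fun i hi => ?_
    linear_combination (-C (p : ℚ) * X) * hinv i hi
  have h2 : ∏ i ∈ Finset.Icc 1 (p - 1),
      ((1 + (C (p : ℚ) * (X - 1)) * C (1 / (i : ℚ))) * C (i : ℚ)) =
      ∏ i ∈ Finset.Icc 1 (p - 1), (-1 * (C ((p - i : ℕ) : ℚ) - C (p : ℚ) * X)) := by
    refine Finset.prod_congr rfl fun i hi => ?_
    rw [Nat.cast_sub (by have := (Finset.mem_Icc.1 hi).2; omega), C_sub]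
    linear_combination (C (p : ℚ) * (X - 1)) * hinv i hi
  rw [h1, h2, Finset.prod_mul_distrib, Finset.prod_const, Nat.card_Icc, Nat.add_sub_cancel,
    hev.neg_one_pow, one_mul]
  refine Finset.prod_nbij' (fun i => p - i) (fun i => p - i) ?_ ?_ ?_ ?_ ?_ <;> intro i hi <;>
    have := Finset.mem_Icc.1 hi
  · simp only [Finset.mem_Icc]; omega
  · simp only [Finset.mem_Icc]; omega
  · omega
  · omega
  · rw [show p - (p - i) = i by omega]

theorem harmonicPolynomial_eq_sum_sub_one {p : ℕ} (hp : Odd p) :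
    harmonicPolynomial p = ∑ j ∈ Finset.range p,
      C ((p : ℚ) ^ j * multipleHarmonicSum (fun _ : Fin j => 1) (p - 1)) * (X - 1) ^ j := by
  rw [harmonicPolynomial_eq_prod_reflected hp, prod_one_add_mul_C_inv, Nat.sub_add_cancel hp.pos]
  refine Finset.sum_congr rfl fun j _ => ?_
  rw [mul_pow, C_mul, C_pow]
  ring

theorem choose_mul_sub_one_eq_eval {p : ℕ} (hp : Odd p) (k : ℤ) :
    ((Ring.choose (k * (p : ℤ) - 1) (p - 1) : ℤ) : ℚ) = (harmonicPolynomial p).eval (k : ℚ) := by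
  have hev : Even (p - 1) := by obtain ⟨a, rfl⟩ := hp; simp
  have h := Ring.descPochhammer_eq_factorial_smul_choose (k * (p : ℤ) - 1) (p - 1)
  rw [← Polynomial.eval_eq_smeval, descPochhammer_eval_eq_prod_range, nsmul_eq_mul] at h
  have h' := congrArg (fun z : ℤ => (z : ℚ)) h
  simp only [Int.cast_prod, Int.cast_mul, Int.cast_natCast] at h'
  have hf : ((p - 1).factorial : ℚ) ≠ 0 := by positivity
  apply mul_left_cancel₀ hf
  rw [← h', harmonicPolynomial, eval_prod, ← prod_Icc_natCast_eq_factorial,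
    ← Finset.prod_mul_distrib]
  have h3 : ∏ i ∈ Finset.Icc 1 (p - 1),
      ((i : ℚ) * (1 + (-C (p : ℚ) * X) * C (1 / (i : ℚ))).eval (k : ℚ)) =
      ∏ i ∈ Finset.Icc 1 (p - 1), (-1 * ((k : ℚ) * p - i)) := by
    refine Finset.prod_congr rfl fun i hi => ?_
    have : (i : ℚ) ≠ 0 := by have := (Finset.mem_Icc.1 hi).1; positivity
    simp only [eval_add, eval_one, eval_mul, eval_neg, eval_C, eval_X]
    field_simp
    ring
  rw [h3, Finset.prod_mul_distrib, Finset.prod_const, Nat.card_Icc, Nat.add_sub_cancel,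
    hev.neg_one_pow, one_mul, ← Finset.Ico_add_one_right_eq_Icc,
    Finset.prod_Ico_eq_prod_range, Nat.add_sub_cancel]
  refine Finset.prod_congr rfl fun i _ => ?_
  push_cast
  ring

/-! ### The error term as a quotient -/

/-- The polynomial `T ^ (n + 1) (T - 1) ^ (n + 1)`, over `ℤ` so that division by it visibly preserves
integrality. -/
noncomputable def errorModulus (n : ℕ) : ℤ[X] := X ^ (n + 1) * (X - 1) ^ (n + 1)

theorem errorModulus_monic (n : ℕ) : (errorModulus n).Monic := by
  have h1 : (X - 1 : ℤ[X]).Monic := by simpa using monic_X_sub_C (1 : ℤ)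
  exact (monic_X.pow _).mul (h1.pow _)

theorem natDegree_errorModulus (n : ℕ) : (errorModulus n).natDegree = 2 * n + 2 := by
  have h1 : (X - 1 : ℤ[X]).Monic := by simpa using monic_X_sub_C (1 : ℤ)
  have h2 : (X - 1 : ℤ[X]).natDegree = 1 := by simpa using natDegree_X_sub_C (1 : ℤ)
  rw [errorModulus, (monic_X.pow _).natDegree_mul (h1.pow _), h1.natDegree_pow, natDegree_X_pow, h2]
  ring

/-- The value at `k` of the quotient of `T ^ j` by `T ^ (n + 1) (T - 1) ^ (n + 1)`. It is an integer
because the divisor is monic with integer coefficients. -/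
noncomputable def errorCoeff (n j : ℕ) (k : ℤ) : ℤ :=
  (X ^ j /ₘ errorModulus n).eval k

theorem errorCoeff_of_lt {n j : ℕ} (hj : j < 2 * n + 2) (k : ℤ) : errorCoeff n j k = 0 := by
  rw [errorCoeff, (divByMonic_eq_zero_iff (errorModulus_monic n)).2, eval_zero]
  refine degree_lt_degree ?_
  rwa [natDegree_X_pow, natDegree_errorModulus]

theorem errorCoeff_self (n : ℕ) (k : ℤ) : errorCoeff n (2 * n + 2) k = 1 := by
  rw [errorCoeff, (div_modByMonic_unique 1 (X ^ (2 * n + 2) - errorModulus n)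
    (errorModulus_monic n) ⟨by ring, ?_⟩).1, eval_one]
  have hd : (X ^ (2 * n + 2) : ℤ[X]).degree = (errorModulus n).degree := by
    rw [degree_X_pow, degree_eq_natDegree (errorModulus_monic n).ne_zero, natDegree_errorModulus]
  rw [← hd]
  refine degree_sub_lt_left hd (pow_ne_zero _ X_ne_zero) ?_
  rw [(errorModulus_monic n).leadingCoeff, (monic_X_pow _).leadingCoeff]

/-- The polynomial in `T` whose value at `k` is `optimizedSum n p k`. -/
noncomputable def optimizedPolynomial (n p : ℕ) : ℚ[X] :=
  ∑ j ∈ Finset.range (n + 1),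
    C ((p : ℚ) ^ j * multipleHarmonicSum (fun _ : Fin j => 1) (p - 1)) * extremalPolynomial j n

theorem eval_optimizedPolynomial (n p : ℕ) (k : ℤ) :
    (optimizedPolynomial n p).eval (k : ℚ) = optimizedSum n p k := by
  rw [optimizedPolynomial, optimizedSum, eval_finsetSum]
  refine Finset.sum_congr rfl fun j _ => ?_
  rw [eval_mul, eval_C]
  ring

theorem natDegree_optimizedPolynomial_le (n p : ℕ) :
    (optimizedPolynomial n p).natDegree ≤ 2 * n + 1 :=
  natDegree_sum_le_of_forall_le _ _ fun j _ => (natDegree_C_mul_le _ _).trans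
    (isExtremalPolynomial_extremalPolynomial j n).natDegree_le

/-- `optimizedPolynomial n p` agrees with the expansion of `harmonicPolynomial p` at `0` modulo
`T ^ (n + 1)` and with the one at `1` modulo `(T - 1) ^ (n + 1)`. -/
theorem dvd_harmonicPolynomial_sub_optimizedPolynomial {n p : ℕ} (hp : Odd p) (hn : n < p) :
    (errorModulus n).map (Int.castRingHom ℚ) ∣
      harmonicPolynomial p - optimizedPolynomial n p := by
  have hsplit (g : ℕ → ℚ[X]) : ∑ j ∈ Finset.range p, g j =
      ∑ j ∈ Finset.range (n + 1), g j + ∑ j ∈ Finset.Ico (n + 1) p, g j :=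
    (Finset.sum_range_add_sum_Ico g hn).symm
  have hco : IsCoprime (X ^ (n + 1)) ((X - 1 : ℚ[X]) ^ (n + 1)) :=
    IsCoprime.pow ⟨1, -1, by ring⟩
  have hM : (errorModulus n).map (Int.castRingHom ℚ) = X ^ (n + 1) * (X - 1) ^ (n + 1) := by
    simp [errorModulus]
  rw [hM]
  refine hco.mul_dvd ?_ ?_
  · rw [harmonicPolynomial_eq_sum p hp.pos, hsplit, optimizedPolynomial, add_sub_right_comm,
      ← Finset.sum_sub_distrib]
    refine dvd_add (Finset.dvd_sum fun j _ => ?_) (Finset.dvd_sum fun j hj => ?_)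
    · have h := (isExtremalPolynomial_extremalPolynomial j n).congr_zero.mul_left
        (-C ((p : ℚ) ^ j * multipleHarmonicSum (fun _ : Fin j => 1) (p - 1)))
      convert! h using 1
      simp only [map_mul, map_pow, map_neg, map_one]
      ring
    · exact (pow_dvd_pow X (Finset.mem_Ico.1 hj).1).mul_left _
  · rw [harmonicPolynomial_eq_sum_sub_one hp, hsplit, optimizedPolynomial, add_sub_right_comm,
      ← Finset.sum_sub_distrib]
    refine dvd_add (Finset.dvd_sum fun j _ => ?_) (Finset.dvd_sum fun j hj => ?_)
    · have h := (isExtremalPolynomial_extremalPolynomial j n).congr_one.mul_left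
        (-C ((p : ℚ) ^ j * multipleHarmonicSum (fun _ : Fin j => 1) (p - 1)))
      convert! h using 1
      ring
    · exact (pow_dvd_pow (X - 1) (Finset.mem_Ico.1 hj).1).mul_left _

/-- The value at `k` of the quotient of `harmonicPolynomial p` by `errorModulus n`, computed term by
term from the coefficients of `harmonicPolynomial p`. -/
noncomputable def errorQuotient (n p : ℕ) (k : ℤ) : ℚ :=
  ∑ j ∈ Finset.range p,
    (-1) ^ j * (p : ℚ) ^ j * multipleHarmonicSum (fun _ : Fin j => 1) (p - 1) * errorCoeff n j k

/-- By degree, `optimizedPolynomial n p` is the remainder of `harmonicPolynomial p` modulo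
`errorModulus n`, so the error is the modulus times the quotient. -/
theorem choose_sub_optimizedSum {n p : ℕ} (hp : Odd p) (hn : n < p) (k : ℤ) :
    ((Ring.choose (k * (p : ℤ) - 1) (p - 1) : ℤ) : ℚ) - optimizedSum n p k =
      (k : ℚ) ^ (n + 1) * ((k : ℚ) - 1) ^ (n + 1) * errorQuotient n p k := by
  set φ := Int.castRingHom ℚ with hφ
  set M := (errorModulus n).map φ with hM
  have hMm : M.Monic := (errorModulus_monic n).map φ
  have hMd : M.natDegree = 2 * n + 2 := by
    rw [hM, (errorModulus_monic n).natDegree_map, natDegree_errorModulus]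
  set c : ℕ → ℚ := fun j =>
    (-1) ^ j * (p : ℚ) ^ j * multipleHarmonicSum (fun _ : Fin j => 1) (p - 1) with hc
  have hdiv : harmonicPolynomial p = M * ∑ j ∈ Finset.range p, C (c j) *
      (X ^ j /ₘ errorModulus n).map φ + optimizedPolynomial n p := by
    have hlt : (optimizedPolynomial n p).degree < M.degree := by
      refine degree_lt_degree ?_
      have := natDegree_optimizedPolynomial_le n p
      omega
    have h1 := div_modByMonic_unique (harmonicPolynomial p /ₘ M) (harmonicPolynomial p %ₘ M) hMm
      ⟨modByMonic_add_div _ _, degree_modByMonic_lt _ hMm⟩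
    obtain ⟨q, hq⟩ := dvd_harmonicPolynomial_sub_optimizedPolynomial hp hn
    have h2 := div_modByMonic_unique q (optimizedPolynomial n p) hMm (f := harmonicPolynomial p)
      ⟨by rw [← hq]; ring, hlt⟩
    have h3 : harmonicPolynomial p /ₘ M =
        ∑ j ∈ Finset.range p, C (c j) * (X ^ j /ₘ errorModulus n).map φ := by
      have hlin (s : Finset ℕ) : (∑ j ∈ s, C (c j) * X ^ j) /ₘ M =
          ∑ j ∈ s, C (c j) * (X ^ j /ₘ errorModulus n).map φ := by
        refine (div_modByMonic_unique _ (∑ j ∈ s, C (c j) * (X ^ j %ₘ M)) hMm ⟨?_, ?_⟩).1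
        · rw [Finset.mul_sum, ← Finset.sum_add_distrib]
          refine Finset.sum_congr rfl fun j _ => ?_
          have := modByMonic_add_div (X ^ j) M
          rw [map_divByMonic φ (errorModulus_monic n), Polynomial.map_pow, map_X, ← hM]
          linear_combination C (c j) * this
        · refine (degree_sum_le _ _).trans_lt ((Finset.sup_lt_iff ?_).2 fun j _ => ?_)
          · rw [bot_lt_iff_ne_bot, Ne, degree_eq_bot]; exact hMm.ne_zero
          · rw [← smul_eq_C_mul]
            exact (degree_smul_le _ _).trans_lt (degree_modByMonic_lt _ hMm)
      rw [harmonicPolynomial_eq_sum p hp.pos]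
      exact hlin _
    rw [← h3, ← h2.2, add_comm]
    exact (modByMonic_add_div _ _).symm
  rw [choose_mul_sub_one_eq_eval hp, hdiv, eval_add, eval_optimizedPolynomial, add_sub_cancel_right,
    eval_mul, eval_finsetSum, errorQuotient]
  congr 1
  · simp [hM, errorModulus]
  · refine Finset.sum_congr rfl fun j _ => ?_
    rw [eval_mul, eval_C]
    congr 1
    simp [hφ, errorCoeff]

/-- When `p = 2n + 3` the polynomial `harmonicPolynomial p` has the same degree as the modulus, so
the quotient is its leading coefficient. -/
theorem errorQuotient_eq_of_eq {n p : ℕ} (h : p = 2 * n + 3) (k : ℤ) :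
    errorQuotient n p k = (p : ℚ) ^ (2 * n + 2) / (p - 1).factorial := by
  have hf : ((p - 1).factorial : ℚ) ≠ 0 := by positivity
  rw [errorQuotient, Finset.sum_eq_single (2 * n + 2), errorCoeff_self]
  · have hH := factorial_mul_multipleHarmonicSum (m := p - 1) (j := 2 * n + 2) (by omega)
    rw [show p - 1 - (2 * n + 2) = 0 by omega, Finset.powersetCard_zero, Finset.sum_singleton,
      Finset.prod_empty] at hH
    rw [eq_div_iff hf, (show Even (2 * n + 2) from ⟨n + 1, by ring⟩).neg_one_pow,
      Int.cast_one]
    linear_combination (p : ℚ) ^ (2 * n + 2) * hH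
  · intro j hj hne
    have hj := Finset.mem_range.1 hj
    rw [errorCoeff_of_lt (by omega)]
    simp
  · intro hn
    exact absurd (Finset.mem_range.2 (by omega)) hn

end

/-! ### The `p`-adic filtration of the rationals -/

/-- The additive group `p ^ m ℤ_(p)` of the rational numbers of `p`-adic valuation at least `m`. In
particular `padicFiltration p 0` is the ring of `p`-integral rationals. -/
noncomputable def padicFiltration (p : ℕ) [Fact p.Prime] (m : ℕ) : AddSubgroup ℚ where
  carrier := {x | x / (p : ℚ) ^ m ∈ (Rat.padicValuation p).integer}
  zero_mem' := by simp
  add_mem' {a b} ha hb := by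
    simp only [Set.mem_ofPred_eq] at *
    rw [add_div]
    exact add_mem ha hb
  neg_mem' {a} ha := by
    simp only [Set.mem_ofPred_eq] at *
    rw [neg_div]
    exact neg_mem ha

namespace padicFiltration

variable {p : ℕ} [hp : Fact p.Prime] {m m' : ℕ} {x y : ℚ}

theorem mem_zero_iff : x ∈ padicFiltration p 0 ↔ ¬ p ∣ x.den := by
  rw [← Rat.padicValuation_le_one_iff]
  change x / (p : ℚ) ^ 0 ∈ (Rat.padicValuation p).integer ↔ _
  rw [pow_zero, div_one, Valuation.mem_integer_iff]

theorem prime_ne_zero : (p : ℚ) ≠ 0 := Nat.cast_ne_zero.2 hp.out.ne_zero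

theorem mem_iff_div_mem : x ∈ padicFiltration p m ↔ x / (p : ℚ) ^ m ∈ padicFiltration p 0 := by
  change x / (p : ℚ) ^ m ∈ (Rat.padicValuation p).integer ↔
    x / (p : ℚ) ^ m / (p : ℚ) ^ 0 ∈ (Rat.padicValuation p).integer
  rw [pow_zero, div_one]

theorem ratCongr_iff : RatCongr p m x y ↔ x - y ∈ padicFiltration p m := by
  have h0 : (p : ℚ) ^ m ≠ 0 := pow_ne_zero _ (prime_ne_zero (p := p))
  rw [mem_iff_div_mem, mem_zero_iff]
  constructor
  · rintro ⟨r, hr, h⟩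
    rw [h, mul_div_cancel_left₀ _ h0]
    exact (Nat.Prime.coprime_iff_not_dvd hp.out).1 hr.symm
  · intro h
    exact ⟨_, ((Nat.Prime.coprime_iff_not_dvd hp.out).2 h).symm, (mul_div_cancel₀ _ h0).symm⟩

theorem pow_mul_mem_iff (a : ℕ) :
    (p : ℚ) ^ a * x ∈ padicFiltration p (a + m) ↔ x ∈ padicFiltration p m := by
  have h0 : (p : ℚ) ^ a ≠ 0 := pow_ne_zero _ (prime_ne_zero (p := p))
  rw [mem_iff_div_mem, mem_iff_div_mem (m := m), pow_add, mul_div_mul_left _ _ h0]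

theorem mul_mem (hx : x ∈ padicFiltration p m) (hy : y ∈ padicFiltration p m') :
    x * y ∈ padicFiltration p (m + m') := by
  change x / (p : ℚ) ^ m ∈ (Rat.padicValuation p).integer at hx
  change y / (p : ℚ) ^ m' ∈ (Rat.padicValuation p).integer at hy
  change x * y / (p : ℚ) ^ (m + m') ∈ (Rat.padicValuation p).integer
  rw [pow_add, mul_div_mul_comm]
  exact MulMemClass.mul_mem hx hy

theorem mul_mem_left (hx : x ∈ padicFiltration p 0) (hy : y ∈ padicFiltration p m) :
    x * y ∈ padicFiltration p m := by
  simpa using mul_mem hx hy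

theorem intCast_mem_zero (z : ℤ) : (z : ℚ) ∈ padicFiltration p 0 := by
  rw [mem_zero_iff]
  simpa using hp.out.one_lt.ne'

theorem natCast_mem_zero (z : ℕ) : (z : ℚ) ∈ padicFiltration p 0 := intCast_mem_zero z

theorem mono (h : m ≤ m') (hx : x ∈ padicFiltration p m') : x ∈ padicFiltration p m := by
  obtain ⟨d, rfl⟩ := Nat.exists_eq_add_of_le' h
  have h0 : (p : ℚ) ^ d ≠ 0 := pow_ne_zero _ (prime_ne_zero (p := p))
  rw [← mul_div_cancel₀ x h0, pow_mul_mem_iff] at hx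
  rw [← mul_div_cancel₀ x h0]
  exact mul_mem_left (by exact_mod_cast natCast_mem_zero (p ^ d)) hx

theorem intCast_mem_one_iff (z : ℤ) : (z : ℚ) ∈ padicFiltration p 1 ↔ (p : ℤ) ∣ z := by
  constructor
  · intro h
    rw [mem_iff_div_mem, pow_one, mem_zero_iff] at h
    by_contra hz
    have hco : Nat.Coprime z.natAbs p :=
      ((Nat.Prime.coprime_iff_not_dvd hp.out).2 (mt Int.natCast_dvd.2 hz)).symm
    have := Rat.den_div_eq_of_coprime (a := z) (b := p) (by exact_mod_cast hp.out.pos)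
      (by simpa using hco)
    push_cast at this
    apply h
    exact_mod_cast this.symm.dvd
  · rintro ⟨w, rfl⟩
    have := (pow_mul_mem_iff (p := p) (m := 0) 1).2 (intCast_mem_zero w)
    simpa using this

theorem inv_mem_zero {u : ℕ} (hu : ¬ p ∣ u) : (u : ℚ)⁻¹ ∈ padicFiltration p 0 := by
  rw [mem_zero_iff]
  have : u ≠ 0 := by rintro rfl; simp at hu
  rwa [Rat.inv_natCast_den_of_pos (Nat.pos_of_ne_zero this)]

theorem unit_mul_mem_iff {u : ℕ} (hu : ¬ p ∣ u) :
    (u : ℚ) * x ∈ padicFiltration p m ↔ x ∈ padicFiltration p m := by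
  have h0 : (u : ℚ) ≠ 0 := by rintro h; simp_all
  refine ⟨fun h => ?_, mul_mem_left (natCast_mem_zero u)⟩
  have := mul_mem_left (inv_mem_zero hu) h
  rwa [inv_mul_cancel_left₀ h0] at this

theorem prime_mem_one : (p : ℚ) ∈ padicFiltration p 1 := by
  have := (intCast_mem_one_iff (p := p) p).2 dvd_rfl
  exact_mod_cast this

/-! ### Bernoulli numbers and power sums -/

theorem bernoulli_mem_zero {r : ℕ} (hr : r + 1 < p) : bernoulli r ∈ padicFiltration p 0 := by
  induction r using Nat.strong_induction_on with
  | _ r ih =>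
    have h := sum_bernoulli (r + 1)
    rw [Finset.sum_range_succ] at h
    have hu : ¬ p ∣ r + 1 := Nat.not_dvd_of_pos_of_lt (Nat.succ_pos r) hr
    rw [← unit_mul_mem_iff hu]
    have h' : ((r + 1 : ℕ) : ℚ) * bernoulli r = (if r + 1 = 1 then 1 else 0) -
        ∑ x ∈ Finset.range r, ((r + 1).choose x : ℚ) * bernoulli x := by
      rw [← h, Nat.choose_succ_self_right]; ring
    rw [h']
    refine sub_mem ?_ (sum_mem fun i hi => ?_)
    · split_ifs
      · exact_mod_cast natCast_mem_zero (p := p) 1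
      · exact zero_mem _
    · have hi := Finset.mem_range.1 hi
      exact mul_mem_left (natCast_mem_zero _) (ih i hi (by omega))

/-- In Faulhaber's formula for `∑_{i < p} i ^ r`, the term with `B_i` carries `p ^ (r + 1 - i)`, so
modulo `p ^ 2` only `i = r` remains. -/
theorem sum_pow_sub_prime_mul_bernoulli_mem {r : ℕ} (h1 : 1 ≤ r) (hr : r + 1 < p) :
    ∑ i ∈ Finset.Icc 1 (p - 1), (i : ℚ) ^ r - p * bernoulli r ∈ padicFiltration p 2 := by
  have hsum : ∑ i ∈ Finset.Icc 1 (p - 1), (i : ℚ) ^ r = ∑ i ∈ Finset.range p, (i : ℚ) ^ r := by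
    rw [Finset.range_eq_Ico, Finset.sum_eq_sum_Ico_succ_bot hp.out.pos, Nat.cast_zero,
      zero_pow (by omega), zero_add, ← Finset.Ico_add_one_right_eq_Icc,
      Nat.sub_add_cancel hp.out.one_le, zero_add]
  have hr0 : (r : ℚ) + 1 ≠ 0 := by positivity
  rw [hsum, sum_range_pow, Finset.sum_range_succ, Nat.choose_succ_self_right,
    Nat.add_sub_cancel_left, pow_one, Nat.cast_succ, mul_right_comm, mul_div_cancel_right₀ _ hr0,
    mul_comm (bernoulli r), add_sub_cancel_right]
  refine sum_mem fun i hi => ?_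
  have hi := Finset.mem_range.1 hi
  rw [← unit_mul_mem_iff (Nat.not_dvd_of_pos_of_lt (Nat.succ_pos r) hr), Nat.cast_succ,
    mul_div_cancel₀ _ hr0]
  refine mul_mem_left (mul_mem_left (bernoulli_mem_zero (by omega)) (natCast_mem_zero _)) ?_
  refine mono (m' := r + 1 - i + 0) (by omega) ?_
  have := (pow_mul_mem_iff (p := p) (m := 0) (x := 1) (r + 1 - i)).2
    (by exact_mod_cast natCast_mem_zero (p := p) 1)
  rwa [mul_one] at this

theorem sum_pow_mem_one {r : ℕ} (h1 : 1 ≤ r) (hr : r + 1 < p) :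
    ∑ i ∈ Finset.Icc 1 (p - 1), (i : ℚ) ^ r ∈ padicFiltration p 1 := by
  have hB : (p : ℚ) * bernoulli r ∈ padicFiltration p 1 :=
    mul_mem (m := 1) (m' := 0) prime_mem_one (bernoulli_mem_zero hr)
  have h := add_mem (mono one_le_two (sum_pow_sub_prime_mul_bernoulli_mem h1 hr)) hB
  rwa [sub_add_cancel] at h

end padicFiltration

section

open padicFiltration

variable {p : ℕ} [hp : Fact p.Prime]

/-! ### Elementary symmetric functions of `1, …, p - 1` modulo `p ^ 2` -/

/-- In Newton's identity for the elementary symmetric function of degree `r` of `1, …, p - 1`, the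
terms other than the power sum of degree `r` are products of two multiples of `p`, provided that the
functions of lower degree are known to be multiples of `p`. -/
theorem mul_esymm_sub_mem {r : ℕ} (h1 : 1 ≤ r) (hr : r + 1 < p)
    (he : ∀ a, 1 ≤ a → a < r →
      ∑ t ∈ (Finset.Icc 1 (p - 1)).powersetCard a, ∏ i ∈ t, (i : ℚ) ∈ padicFiltration p 1) :
    r * ∑ t ∈ (Finset.Icc 1 (p - 1)).powersetCard r, ∏ i ∈ t, (i : ℚ) -
      (-1) ^ (r + 1) * (p * bernoulli r) ∈ padicFiltration p 2 := by
  have hsign (a : ℕ) : ((-1) ^ a : ℚ) ∈ padicFiltration p 0 := by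
    exact_mod_cast intCast_mem_zero (p := p) ((-1) ^ a)
  have hmem : ((0, r) : ℕ × ℕ) ∈ (Finset.HasAntidiagonal.antidiagonal r).filter
      (fun a => a.1 < r) := by simp; omega
  -- The pair `(0, r)` contributes the power sum of degree `r`.
  rw [Finset.newton_identity, ← Finset.add_sum_erase _ _ hmem, ← mul_sub]
  refine mul_mem_left (hsign _) ?_
  simp only [pow_zero, Finset.powersetCard_zero, Finset.sum_singleton, Finset.prod_empty, one_mul]
  rw [add_sub_right_comm]
  refine add_mem (sum_pow_sub_prime_mul_bernoulli_mem h1 hr) (sum_mem fun a ha => ?_)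
  obtain ⟨hne, ha⟩ := Finset.mem_erase.1 ha
  obtain ⟨ha, hlt⟩ := Finset.mem_filter.1 ha
  rw [Finset.HasAntidiagonal.mem_antidiagonal] at ha
  have ha1 : 1 ≤ a.1 := by
    by_contra h0
    exact hne (Prod.ext (by simp; omega) (by simp; omega))
  exact mul_mem (m := 1) (m' := 1) (mul_mem_left (hsign _) (he _ ha1 hlt))
    (sum_pow_mem_one (by omega) (by omega))

theorem esymm_mem_one {r : ℕ} (h1 : 1 ≤ r) (hr : r + 1 < p) :
    ∑ t ∈ (Finset.Icc 1 (p - 1)).powersetCard r, ∏ i ∈ t, (i : ℚ) ∈ padicFiltration p 1 := by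
  induction r using Nat.strong_induction_on with
  | _ r ih =>
    have h := mul_esymm_sub_mem h1 hr fun a ha1 har => ih a har ha1 (by omega)
    have hB : (-1) ^ (r + 1) * ((p : ℚ) * bernoulli r) ∈ padicFiltration p 1 :=
      mul_mem_left (by exact_mod_cast intCast_mem_zero (p := p) ((-1) ^ (r + 1)))
        (mul_mem (m := 1) (m' := 0) prime_mem_one (bernoulli_mem_zero hr))
    have h2 := add_mem (mono one_le_two h) hB
    rw [sub_add_cancel] at h2
    exact (unit_mul_mem_iff (Nat.not_dvd_of_pos_of_lt h1 (by omega))).1 h2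

/-! ### Multiple harmonic sums modulo `p ^ 2` -/

theorem not_dvd_factorial_pred : ¬ p ∣ (p - 1).factorial := by
  rw [hp.out.dvd_factorial]
  have := hp.out.pos
  omega

theorem multipleHarmonicSum_mem_zero (j : ℕ) :
    multipleHarmonicSum (fun _ : Fin j => 1) (p - 1) ∈ padicFiltration p 0 := by
  rcases le_or_gt j (p - 1) with hj | hj
  · rw [← unit_mul_mem_iff not_dvd_factorial_pred, factorial_mul_multipleHarmonicSum hj]
    exact sum_mem fun t _ => by
      simpa using natCast_mem_zero (p := p) (∏ i ∈ t, i)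
  · rw [multipleHarmonicSum_one_eq, Finset.powersetCard_eq_empty.2 (by simpa using hj)]
    exact zero_mem _

theorem multipleHarmonicSum_mem_one {j : ℕ} (h1 : 1 ≤ j) (hj : j + 1 < p) :
    multipleHarmonicSum (fun _ : Fin j => 1) (p - 1) ∈ padicFiltration p 1 := by
  rw [← unit_mul_mem_iff not_dvd_factorial_pred, factorial_mul_multipleHarmonicSum (by omega)]
  exact esymm_mem_one (by omega) (by omega)

theorem factorial_pred_add_one_mem_one : ((p - 1).factorial : ℚ) + 1 ∈ padicFiltration p 1 := by
  have h : (((p - 1).factorial + 1 : ℤ) : ZMod p) = 0 := by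
    push_cast
    rw [ZMod.wilsons_lemma, neg_add_cancel]
  have := (intCast_mem_one_iff (p := p) _).2 ((ZMod.intCast_zmod_eq_zero_iff_dvd _ p).1 h)
  exact_mod_cast this

/-- For `p - 1 - j` even, `H({1}^j; p - 1) ≡ -p B_{p-1-j} / (j + 1)` modulo `p ^ 2`. -/
theorem multipleHarmonicSum_add_mem_two {j : ℕ} (h1 : 1 ≤ j) (hj : j + 1 < p)
    (hev : Even (p - 1 - j)) :
    multipleHarmonicSum (fun _ : Fin j => 1) (p - 1) +
      p * bernoulli (p - 1 - j) / (j + 1) ∈ padicFiltration p 2 := by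
  set r := p - 1 - j with hr
  set H := multipleHarmonicSum (fun _ : Fin j => 1) (p - 1) with hH
  have hp1 := hp.out.pos
  have hfac := factorial_mul_multipleHarmonicSum (m := p - 1) (j := j) (by omega)
  rw [← hr, ← hH] at hfac
  have he1 := esymm_mem_one (p := p) (r := r) (by omega) (by omega)
  have he2 := mul_esymm_sub_mem (p := p) (r := r) (by omega) (by omega)
    fun a h1 h2 => esymm_mem_one h1 (by omega)
  rw [← hfac] at he1 he2
  rw [hev.add_one.neg_one_pow] at he2
  have hcast : (j : ℚ) + 1 = p - r := by
    rw [eq_sub_iff_add_eq]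
    exact_mod_cast (show j + 1 + r = p by omega)
  have hW : (((p - 1).factorial : ℚ) + 1) * H ∈ padicFiltration p 2 :=
    mul_mem (m := 1) (m' := 1) factorial_pred_add_one_mem_one (multipleHarmonicSum_mem_one h1 hj)
  have hP : (p : ℚ) * (((p - 1).factorial : ℚ) * H) ∈ padicFiltration p 2 :=
    mul_mem (m := 1) (m' := 1) prime_mem_one he1
  have hj0 : (j : ℚ) + 1 ≠ 0 := by positivity
  -- With `e = (p - 1)! H` and `j + 1 = p - r`, one has
  -- `(j + 1) H + p B_r = (j + 1) ((p - 1)! + 1) H - p e + (r e + p B_r)`.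
  rw [← unit_mul_mem_iff (Nat.not_dvd_of_pos_of_lt (Nat.succ_pos j) hj), Nat.cast_succ, mul_add,
    mul_div_cancel₀ _ hj0]
  have hW' := mul_mem_left (natCast_mem_zero (p := p) (j + 1)) hW
  have h := add_mem (sub_mem hW' hP) he2
  convert! h using 1
  push_cast
  linear_combination (-(p - 1).factorial * H : ℚ) * hcast

/-! ### The error term modulo powers of the prime -/

/-- Modulo `p ^ (2n + 4)` only the term `j = 2n + 2` of `errorQuotient` counts: the terms below it
vanish, and those above it have valuation at least `j + 1`, or `j` if `j = p - 1`. -/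
theorem errorQuotient_add_mem {n : ℕ} (h : 2 * n + 5 ≤ p) (k : ℤ) :
    errorQuotient n p k + bernoulli (p - 2 * n - 3) / (2 * n + 3) * (p : ℚ) ^ (2 * n + 3) ∈
      padicFiltration p (2 * n + 4) := by
  have hodd : Odd p := hp.out.odd_of_ne_two (by omega)
  rw [errorQuotient, ← Finset.add_sum_erase _ _ (Finset.mem_range.2 (show 2 * n + 2 < p by omega)),
    errorCoeff_self, add_right_comm]
  refine add_mem ?_ (sum_mem fun j hj => ?_)
  · have hH := multipleHarmonicSum_add_mem_two (p := p) (j := 2 * n + 2) (by omega) (by omega)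
      (by obtain ⟨a, rfl⟩ := hodd; exact ⟨a - n - 1, by omega⟩)
    rw [← pow_mul_mem_iff (2 * n + 2), show p - 1 - (2 * n + 2) = p - 2 * n - 3 by omega] at hH
    convert! hH using 1
    rw [(show Even (2 * n + 2) from ⟨n + 1, by ring⟩).neg_one_pow]
    push_cast
    ring
  · obtain ⟨hne, hj⟩ := Finset.mem_erase.1 hj
    have hj := Finset.mem_range.1 hj
    rcases lt_or_ge j (2 * n + 2) with hlt | hge
    · rw [errorCoeff_of_lt hlt]
      simp
    · rw [mul_comm _ (errorCoeff n j k : ℚ)]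
      refine mul_mem_left (intCast_mem_zero (errorCoeff n j k)) ?_
      rw [mul_assoc]
      refine mul_mem_left (by exact_mod_cast intCast_mem_zero (p := p) ((-1) ^ j)) ?_
      rcases eq_or_lt_of_le (show j + 1 ≤ p from hj) with hjp | hjp
      · exact mono (m' := j + 0) (by omega)
          ((pow_mul_mem_iff j).2 (multipleHarmonicSum_mem_zero j))
      · exact mono (m' := j + 1) (by omega)
          ((pow_mul_mem_iff j).2 (multipleHarmonicSum_mem_one (by omega) hjp))

theorem dvd_mul_pow_mul_pow_iff (a k : ℤ) (n : ℕ) :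
    (p : ℤ) ∣ a * k ^ (n + 1) * (k - 1) ^ (n + 1) ↔
      (k ≡ 0 [ZMOD p] ∨ k ≡ 1 [ZMOD p]) ∨ (p : ℤ) ∣ a := by
  have hpr := Nat.prime_iff_prime_int.1 hp.out
  rw [hpr.dvd_mul, hpr.dvd_mul, hpr.dvd_pow_iff_dvd n.succ_ne_zero,
    hpr.dvd_pow_iff_dvd n.succ_ne_zero, Int.modEq_zero_iff_dvd, Int.modEq_comm, Int.modEq_iff_dvd]
  tauto

theorem natCast_pow_mul_intCast_mem_iff (a : ℕ) (z : ℤ) :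
    (p : ℚ) ^ a * z ∈ padicFiltration p (a + 1) ↔ (p : ℤ) ∣ z := by
  rw [pow_mul_mem_iff, intCast_mem_one_iff]

end

open padicFiltration in
theorem theorem1p2 (n p : ℕ) (hp : p.Prime) (hodd : Odd p) (k : ℤ) :
    (2 * n + 5 ≤ p →
      (RatCongr p (2 * n + 4) (Ring.choose (k * (p : ℤ) - 1) (p - 1) : ℤ) (optimizedSum n p k) ↔
        (k ≡ 0 [ZMOD p] ∨ k ≡ 1 [ZMOD p]) ∨ (p : ℤ) ∣ (bernoulli (p - 2 * n - 3)).num) ∧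
      RatCongr p (2 * n + 4)
        ((Ring.choose (k * (p : ℤ) - 1) (p - 1) : ℤ) - optimizedSum n p k)
        (-bernoulli (p - 2 * n - 3) / (2 * n + 3) *
          (k : ℚ) ^ (n + 1) * ((k : ℚ) - 1) ^ (n + 1) * (p : ℚ) ^ (2 * n + 3))) ∧
    (p = 2 * n + 3 →
      (RatCongr p (2 * n + 3) (Ring.choose (k * (p : ℤ) - 1) (p - 1) : ℤ) (optimizedSum n p k) ↔
        k ≡ 0 [ZMOD p] ∨ k ≡ 1 [ZMOD p])) := by
  have : Fact p.Prime := ⟨hp⟩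
  have hE (hn : n < p) : ((Ring.choose (k * (p : ℤ) - 1) (p - 1) : ℤ) : ℚ) - optimizedSum n p k =
      (k : ℚ) ^ (n + 1) * ((k : ℚ) - 1) ^ (n + 1) * errorQuotient n p k :=
    choose_sub_optimizedSum hodd hn k
  rw [ratCongr_iff, ratCongr_iff, ratCongr_iff]
  refine ⟨fun h => ?_, fun h => ?_⟩
  · rw [hE (by omega)]
    set B := bernoulli (p - 2 * n - 3) with hB
    have hmain : (k : ℚ) ^ (n + 1) * ((k : ℚ) - 1) ^ (n + 1) * errorQuotient n p k -
        -B / (2 * n + 3) * (k : ℚ) ^ (n + 1) * ((k : ℚ) - 1) ^ (n + 1) * (p : ℚ) ^ (2 * n + 3) ∈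
        padicFiltration p (2 * n + 4) := by
      have := mul_mem_left (intCast_mem_zero (k ^ (n + 1) * (k - 1) ^ (n + 1)))
        (errorQuotient_add_mem h k)
      convert! this using 1
      push_cast
      ring
    refine ⟨?_, hmain⟩
    have hiff : (k : ℚ) ^ (n + 1) * ((k : ℚ) - 1) ^ (n + 1) * errorQuotient n p k ∈
        padicFiltration p (2 * n + 4) ↔
        -B / (2 * n + 3) * (k : ℚ) ^ (n + 1) * ((k : ℚ) - 1) ^ (n + 1) * (p : ℚ) ^ (2 * n + 3) ∈
        padicFiltration p (2 * n + 4) :=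
      ⟨fun h => by simpa using sub_mem h hmain, fun h => by simpa using add_mem hmain h⟩
    have hden : ¬ p ∣ B.den := mem_zero_iff.1 (bernoulli_mem_zero (by omega))
    have hu : ¬ p ∣ 2 * n + 3 := Nat.not_dvd_of_pos_of_lt (by omega) (by omega)
    have hu0 : (2 * (n : ℚ) + 3) ≠ 0 := by positivity
    rw [hiff, ← dvd_mul_pow_mul_pow_iff, ← natCast_pow_mul_intCast_mem_iff (2 * n + 3),
      ← unit_mul_mem_iff hu, ← unit_mul_mem_iff hden, ← neg_mem_iff]
    have hBd : (B.den : ℚ) * B = B.num := by rw [mul_comm, Rat.mul_den_eq_num]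
    have hrw : -((B.den : ℚ) * (((2 * n + 3 : ℕ) : ℚ) * (-B / (2 * n + 3) * (k : ℚ) ^ (n + 1) *
        ((k : ℚ) - 1) ^ (n + 1) * (p : ℚ) ^ (2 * n + 3)))) =
        (p : ℚ) ^ (2 * n + 3) * ((B.num * k ^ (n + 1) * (k - 1) ^ (n + 1) : ℤ) : ℚ) := by
      push_cast
      rw [← hBd]
      field_simp
    rw [hrw]
  · have hf : ((p - 1).factorial : ℚ) ≠ 0 := by positivity
    rw [hE (by omega), errorQuotient_eq_of_eq h, ← unit_mul_mem_iff not_dvd_factorial_pred]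
    have hrw : ((p - 1).factorial : ℚ) * ((k : ℚ) ^ (n + 1) * ((k : ℚ) - 1) ^ (n + 1) *
        ((p : ℚ) ^ (2 * n + 2) / (p - 1).factorial)) =
        (p : ℚ) ^ (2 * n + 2) * ((1 * k ^ (n + 1) * (k - 1) ^ (n + 1) : ℤ) : ℚ) := by
      push_cast
      field_simp
    have hone : ¬ (p : ℤ) ∣ 1 := (Nat.prime_iff_prime_int.1 hp).not_dvd_one
    rw [hrw, natCast_pow_mul_intCast_mem_iff, dvd_mul_pow_mul_pow_iff, or_iff_left hone]
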